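/- There is an absolute constant $C>0$ such that the following holds for all integers $d,n,k\ge 1$. Let $\mathcal P=\{P_1,\dots,P_n\}$ be uncertain points in $\mathbb R^d$, where $P_i$ has $k$ equally likely locations $p_{i,1},\dots,p_{i,k}\in\mathbb R^d$. A traversal $Q=(q_1,\dots,q_n)$ is obtained by choosing one index $j_i\in\{1,\dots,k\}$ and putting $q_i=p_{i,j_i}$ for every $i$; there are $k^n$ traversals, counted by their choices of indices. Let $\mathrm{cost}(x,Q)=\frac1n\sum_{i=1}^n\|x-q_i\|$ (Euclidean norm), and let $Q\mapsto m_Q$ be any fixed rule that selects an $L_1$ median, i.e. a minimizer over $x\in\mathbb R^d$ of $\mathrm{cost}(x,Q)$. Let $\widehat{\mathrm{cost}}(x)=\frac1n\sum_{i=1}^n\min_{1\le j\le k}\|x-p_{i,j}\|$, and say that $z$ can $\eta$-cover $q$ if $\|z-q\|\le\eta\,\widehat{\mathrm{cost}}(z)$. Write $M_{\mathcal P}$ for the set of the medians $m_Q$ of all traversals, and $w(q)=k^{-n}\,|\{Q : m_Q=q\}|$. Let $\varepsilon>0$, $\delta\in(0,1)$, and let $T=\{z_1,\dots,z_m\}\subset\mathbb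 R^d$ be a finite set. For $q\in M_{\mathcal P}$ let $f_T(q)$ be the point closest to $q$ among the points $z\in T$ that can $\frac{\varepsilon}{1+\varepsilon}$-cover $q$, ties being broken in favour of the lexicographically smallest coordinate vector. (If no point of $T$ can $\frac{\varepsilon}{1+\varepsilon}$-cover $q$, then $f_T(q)$ is undefined and equals no $z_i$; this never happens when $T$ is an $\frac{\varepsilon}{1+\varepsilon}$-cover of $M_{\mathcal P}$.) The true weight of $z_i$ is $$\hat w_i=\sum_{q\in M_{\mathcal P},\ f_T(q)=z_i} w(q).$$ The sampling algorithm draws $N$ independent, uniformly random traversals $Q_1,\dots,Q_N$ and returns the empirical weights $$c_i=\frac1N\,\bigl|\{\,j\in\{1,\dots,N\} : f_T(m_{Q_j})=z_i\,\}\bigr|,\qquad i=1,\dots,m.$$ If $N\ge C\,\varepsilon^{-2}\bigl(d+\log(1/\delta)\bigr)$, then $$\Pr\Bigl[\,|c_i-\hat w_i|\le\varepsilon\ \text{ for all } i\in\{1,\dots,m\}\Bigr]>1-\delta .$$ -/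

import Mathlib

open MeasureTheory ProbabilityTheory

noncomputable section

namespace UncertainMedian

/-- Euclidean `d`-space. -/
abbrev E (d : ℕ) : Type := EuclideanSpace ℝ (Fin d)

/-- A family of `n` uncertain points in `ℝᵈ`: `P i j` is the `j`-th of the `k` equally likely
locations of the `i`-th uncertain point. -/
abbrev UncertainPoints (d n k : ℕ) : Type := Fin n → Fin k → E d

/-- A traversal picks one of the `k` locations for each of the `n` uncertain points; there are
`k ^ n` of them. -/
abbrev Traversal (n k : ℕ) : Type := Fin n → Fin k

/-- The point set `Q = {q₁, …, qₙ}` (with multiplicities) that a traversal selects. -/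
def Traversal.points {d n k : ℕ} (t : Traversal n k) (P : UncertainPoints d n k) : Fin n → E d :=
  fun i => P i (t i)

/-- `cost(x, Q) = (1/n) ∑ᵢ ‖x - qᵢ‖`. -/
def cost {d n : ℕ} (x : E d) (Q : Fin n → E d) : ℝ :=
  (1 / (n : ℝ)) * ∑ i, ‖x - Q i‖

/-- `x` is an `L₁` median of `Q`: a global minimizer of `cost(·, Q)`. -/
def IsL1Median {d n : ℕ} (x : E d) (Q : Fin n → E d) : Prop :=
  ∀ y : E d, cost x Q ≤ cost y Q

/-- `hatCost(x) = (1/n) ∑ᵢ minⱼ ‖x - p_{i,j}‖` (for `k ≥ 1` the infimum is a minimum over a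
finite nonempty family). -/
def hatCost {d n k : ℕ} (P : UncertainPoints d n k) (x : E d) : ℝ :=
  (1 / (n : ℝ)) * ∑ i, ⨅ j, ‖x - P i j‖

/-- `z` can `η`-cover `q`. -/
def Covers {d n k : ℕ} (P : UncertainPoints d n k) (η : ℝ) (z q : E d) : Prop :=
  ‖z - q‖ ≤ η * hatCost P z

/-- `z` is the point of `T` assigned to `q`: among the points of `T` that can
`ε/(1+ε)`-cover `q` it is closest to `q`, ties being broken in favour of the lexicographically
smallest coordinate vector. -/
def IsAssigned {d n k : ℕ} (P : UncertainPoints d n k) (ε : ℝ) (T : Finset (E d))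
    (q z : E d) : Prop :=
  z ∈ T ∧ Covers P (ε / (1 + ε)) z q ∧
    ∀ y ∈ T, Covers P (ε / (1 + ε)) y q →
      ‖q - z‖ < ‖q - y‖ ∨ (‖q - z‖ = ‖q - y‖ ∧ toLex (⇑z) ≤ toLex (⇑y))

theorem IsAssigned.unique {d n k : ℕ} {P : UncertainPoints d n k} {ε : ℝ} {T : Finset (E d)}
    {q z z' : E d} (h : IsAssigned P ε T q z) (h' : IsAssigned P ε T q z') : z = z' := by
  have a := h.2.2 z' h'.1 h'.2.1
  have b := h'.2.2 z h.1 h.2.1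
  rcases a with a | ⟨a, a'⟩
  · rcases b with b | ⟨b, _⟩ <;> linarith
  · rcases b with b | ⟨_, b'⟩
    · linarith
    · have e : toLex (⇑z) = toLex (⇑z') := le_antisymm a' b'
      ext i
      exact congrFun (toLex.injective e) i

/-- As soon as some point of `T` can `ε/(1+ε)`-cover `q`, a point of `T` is assigned to `q`. -/
theorem exists_isAssigned {d n k : ℕ} {P : UncertainPoints d n k} {ε : ℝ} {T : Finset (E d)}
    {q : E d} (h : ∃ z ∈ T, Covers P (ε / (1 + ε)) z q) : ∃ z, IsAssigned P ε T q z := by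
  classical
  obtain ⟨z₀, hz₀, hc₀⟩ := h
  obtain ⟨z, hz, hmin⟩ := (T.filter fun z => Covers P (ε / (1 + ε)) z q).exists_min_image
    (fun z => toLex (‖q - z‖, toLex (⇑z))) ⟨z₀, by simp [hz₀, hc₀]⟩
  rw [Finset.mem_filter] at hz
  refine ⟨z, hz.1, hz.2, fun y hy hyc => ?_⟩
  have := hmin y (by simp [hy, hyc])
  rw [Prod.Lex.toLex_le_toLex] at this
  exact this

open Classical in
/-- The map `f_T`. Its value is `none` exactly when no point of `T` can `ε/(1+ε)`-cover `q`;
if `T` is an `ε/(1+ε)`-cover of the set of medians, it maps every median into `T`. -/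
def coverMap {d n k : ℕ} (P : UncertainPoints d n k) (ε : ℝ) (T : Finset (E d)) (q : E d) :
    Option (E d) :=
  if h : ∃ z, IsAssigned P ε T q z then some h.choose else none

theorem coverMap_eq_some_iff {d n k : ℕ} {P : UncertainPoints d n k} {ε : ℝ}
    {T : Finset (E d)} {q z : E d} : coverMap P ε T q = some z ↔ IsAssigned P ε T q z := by
  unfold coverMap
  split_ifs with h
  · rw [Option.some_inj]
    exact ⟨fun e => e ▸ h.choose_spec, fun hz => h.choose_spec.unique hz⟩
  · simp only [false_iff]
    exact fun hz => h ⟨z, hz⟩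

section Weights

variable {d n k : ℕ} (med : (Fin n → E d) → E d) (P : UncertainPoints d n k)

open Classical in
/-- `M_P`, the finite set of the medians of all traversals. -/
def medianSet : Finset (E d) :=
  Finset.univ.image fun t : Traversal n k => med (t.points P)

open Classical in
/-- `w(q) = k⁻ⁿ · |{Q : q is the median of Q}|`. -/
def medianWeight (q : E d) : ℝ :=
  (1 / (k : ℝ) ^ n) *
    ((Finset.univ.filter fun t : Traversal n k => med (t.points P) = q).card : ℝ)

open Classical in
/-- The true weight `ŵ(z)`: the sum of `w(q)` over the `q ∈ M_P` with `f_T(q) = z`. -/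
def trueWeight (ε : ℝ) (T : Finset (E d)) (z : E d) : ℝ :=
  ∑ q ∈ (medianSet med P).filter (fun q => coverMap P ε T q = some z), medianWeight med P q

open Classical in
/-- The counter of `z` after the `N` rounds of the sampling algorithm, whose `j`-th round draws the
traversal `Q j`, computes its median `q`, and increments the counter of `f_T(q)`. -/
def counter (ε : ℝ) (T : Finset (E d)) {N : ℕ} (Q : Fin N → Traversal n k) (z : E d) : ℕ :=
  (Finset.univ.filter fun j : Fin N =>
    coverMap P ε T (med ((Q j).points P)) = some z).card

/-- The empirical weight of `z` that the algorithm returns: its counter divided by `N`. -/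
def empiricalWeight (ε : ℝ) (T : Finset (E d)) {N : ℕ} (Q : Fin N → Traversal n k)
    (z : E d) : ℝ :=
  (counter med P ε T Q z : ℝ) / (N : ℝ)

end Weights

/-- The joint law of `N` independent traversals, each uniform among all `k ^ n` traversals. -/
def samplingLaw (n k N : ℕ) : Measure (Fin N → Traversal n k) :=
  Measure.pi fun _ => uniformOn (Set.univ : Set (Traversal n k))

end UncertainMedian

end

/-!
The fibres of `f_T` over the points of `T` are disjoint, so the deviations at all points of `T` can
be controlled together, without any combinatorial dimension. To a traversal `t` with median `q`
attach the vector of `ℝ^T` whose `z`-th coordinate is `1` or `0`, according to whether `f_T(q) = z`,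
minus the true weight of `z`. At most one of these indicators is `1`, and the true weights are
nonnegative with sum at most `1`, so the vector has norm at most `√2`; by the definition of the
true weights its mean over all traversals is `0`. The deviations
`cᵢ - ŵᵢ` are the coordinates of the average of `N` independent copies, and it suffices to bound the
Euclidean norm of that average.

This is a Hoeffding inequality in a Hilbert space whose bound does not depend on the dimension
(`card_norm_sum_ge_le`). It rests on the convexity of `u ↦ cosh √u`, which yields
`cosh ‖s + x‖ ≤ cosh ‖s‖ * cosh B + c * ⟪s, x⟫` for `‖x‖ ≤ B`, with `c` independent of `x`
(`cosh_norm_add_le`). Averaged over a centred `x`, the last term vanishes, so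
`cosh (l * ‖X₁ + ⋯ + X_N‖)` has expectation at most `cosh (l * B) ^ N ≤ exp (N * (l * B) ^ 2 / 2)`.
Markov's inequality with `B = √2` and `l = ε / 2` bounds the failure probability by
`2 * exp (- N * ε ^ 2 / 4)`. As `d ≥ 1`, the choice `C = 4` makes this at most `2 * δ / e < δ`.
-/

namespace UncertainMedian

/-! ### A Hoeffding inequality in inner product spaces -/

theorem hasSum_cosh_sqrt {u : ℝ} (hu : 0 ≤ u) :
    HasSum (fun n : ℕ => u ^ n / ((2 * n).factorial : ℝ)) (Real.cosh √u) := by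
  simpa [pow_mul, Real.sq_sqrt hu] using Real.hasSum_cosh √u

/-- All coefficients of the power series of `cosh √u` are nonnegative. -/
theorem convexOn_cosh_sqrt : ConvexOn ℝ (Set.Ici 0) fun u : ℝ => Real.cosh √u := by
  refine ⟨convex_Ici 0, fun x hx y hy a b ha hb hab => ?_⟩
  have hxy : 0 ≤ a • x + b • y := (convex_Ici (0 : ℝ)) hx hy ha hb hab
  refine hasSum_le (fun n => ?_) (hasSum_cosh_sqrt hxy)
    (((hasSum_cosh_sqrt hx).mul_left a).add ((hasSum_cosh_sqrt hy).mul_left b))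
  have h := (convexOn_pow n).2 hx hy ha hb hab
  simp only [smul_eq_mul] at h ⊢
  rw [← mul_div_assoc, ← mul_div_assoc, ← add_div]
  gcongr

section Hoeffding

variable {V : Type*} [NormedAddCommGroup V] [InnerProductSpace ℝ V]

/-- The right-hand side is affine in `x`: it comes from the chord of the convex function `cosh √u`
between `u = (‖s‖ - B) ^ 2` and `u = (‖s‖ + B) ^ 2`. If `‖s‖ * B = 0`, the inner product vanishes
and the value of the quotient does not matter. -/
theorem cosh_norm_add_le (s x : V) {B : ℝ} (hx : ‖x‖ ≤ B) :
    Real.cosh ‖s + x‖ ≤ Real.cosh ‖s‖ * Real.cosh B +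
      Real.sinh ‖s‖ * Real.sinh B / (‖s‖ * B) * inner ℝ s x := by
  have hB : 0 ≤ B := (norm_nonneg x).trans hx
  rcases hB.eq_or_lt with rfl | hB'
  · obtain rfl : x = 0 := norm_le_zero_iff.1 hx
    simp
  rcases eq_or_ne s 0 with rfl | hs
  · simpa [abs_of_nonneg hB] using Real.cosh_le_cosh.2 (abs_le_abs_of_nonneg (norm_nonneg x) hx)
  have ha : 0 < ‖s‖ := norm_pos_iff.2 hs
  set a := ‖s‖
  set v := inner ℝ s x
  have hv : |v| ≤ a * B := (abs_real_inner_le_norm s x).trans (by gcongr)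
  obtain ⟨hv1, hv2⟩ := abs_le.1 hv
  have haB : 0 < a * B := mul_pos ha hB'
  -- Replacing `‖x‖` by `B` only increases the argument of `cosh √u`.
  have hnorm : ‖s + x‖ ≤ √(a ^ 2 + B ^ 2 + 2 * v) := by
    apply Real.le_sqrt_of_sq_le
    rw [norm_add_sq_real]
    nlinarith [norm_nonneg x]
  have hchord := convexOn_cosh_sqrt.2
    (Set.mem_Ici.2 (sq_nonneg (a + B))) (Set.mem_Ici.2 (sq_nonneg (a - B)))
    (show 0 ≤ (1 + v / (a * B)) / 2 from
      by linarith [show -1 ≤ v / (a * B) by rw [le_div_iff₀ haB]; linarith])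
    (show 0 ≤ (1 - v / (a * B)) / 2 from
      by linarith [show v / (a * B) ≤ 1 by rw [div_le_iff₀ haB]; linarith]) (by ring)
  have harg : ((1 + v / (a * B)) / 2) • (a + B) ^ 2 + ((1 - v / (a * B)) / 2) • (a - B) ^ 2
      = a ^ 2 + B ^ 2 + 2 * v := by
    simp only [smul_eq_mul]
    field_simp
    ring
  rw [harg] at hchord
  simp only [Real.sqrt_sq_eq_abs, Real.cosh_abs, smul_eq_mul, Real.cosh_add,
    Real.cosh_sub] at hchord
  calc Real.cosh ‖s + x‖ ≤ Real.cosh √(a ^ 2 + B ^ 2 + 2 * v) :=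
        Real.cosh_le_cosh.2 (abs_le_abs_of_nonneg (norm_nonneg _) hnorm)
    _ ≤ _ := hchord
    _ = _ := by ring

variable {Ω : Type*} [Fintype Ω]

/-- For `X` centred and bounded by `B`, the average of `cosh ‖∑ j, X (Q j)‖` over all
`Q : Fin N → Ω` is at most `cosh B ^ N`. -/
theorem sum_cosh_norm_sum_le {X : Ω → V} {B : ℝ} (hX : ∑ ω, X ω = 0) (hB : ∀ ω, ‖X ω‖ ≤ B)
    (N : ℕ) :
    ∑ Q : Fin N → Ω, Real.cosh ‖∑ j, X (Q j)‖ ≤ (Fintype.card Ω * Real.cosh B) ^ N := by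
  induction N with
  | zero => simp
  | succ N ih =>
    rw [← (Fin.consEquiv fun _ => Ω).sum_comp, Fintype.sum_prod_type_right]
    simp only [Fin.consEquiv_apply, Fin.sum_univ_succ, Fin.cons_zero, Fin.cons_succ]
    calc ∑ Q : Fin N → Ω, ∑ ω, Real.cosh ‖X ω + ∑ j, X (Q j)‖
        ≤ ∑ Q : Fin N → Ω, (Fintype.card Ω * Real.cosh B) * Real.cosh ‖∑ j, X (Q j)‖ := by
          refine Finset.sum_le_sum fun Q _ => ?_
          refine (Finset.sum_le_sum fun ω _ => (add_comm (X ω) _) ▸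
            cosh_norm_add_le (∑ j, X (Q j)) (X ω) (hB ω)).trans_eq ?_
          rw [Finset.sum_add_distrib, ← Finset.mul_sum _ _ (_ / _), ← inner_sum, hX,
            inner_zero_right, mul_zero, add_zero, Finset.sum_const, Finset.card_univ, nsmul_eq_mul]
          ring
      _ ≤ _ := by
          rw [← Finset.mul_sum, pow_succ']
          gcongr

/-- **Hoeffding's inequality** for `N` independent uniform samples of a centred bounded vector,
in counting form. The bound does not depend on the dimension of `V`. -/
theorem card_norm_sum_ge_le {X : Ω → V} {B : ℝ} (hX : ∑ ω, X ω = 0) (hB : ∀ ω, ‖X ω‖ ≤ B)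
    (hB0 : 0 < B) {ε : ℝ} (hε : 0 ≤ ε) (N : ℕ) (S : Finset (Fin N → Ω))
    (hS : ∀ Q ∈ S, N * ε ≤ ‖∑ j, X (Q j)‖) :
    (S.card : ℝ) ≤ 2 * Real.exp (-(N * ε ^ 2 / (2 * B ^ 2))) * (Fintype.card Ω : ℝ) ^ N := by
  -- `l` minimizes the exponent `N * (l * B) ^ 2 / 2 - l * (N * ε)`.
  set l := ε / B ^ 2 with hl
  have hl0 : 0 ≤ l := by positivity
  have hmgf := sum_cosh_norm_sum_le (X := fun ω => l • X ω) (B := l * B)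
    (by rw [← Finset.smul_sum, hX, smul_zero])
    (fun ω => by
      rw [norm_smul, Real.norm_of_nonneg hl0]
      exact mul_le_mul_of_nonneg_left (hB ω) hl0) N
  have hlow : S.card * (Real.exp (l * (N * ε)) / 2) ≤
      ∑ Q : Fin N → Ω, Real.cosh ‖∑ j, l • X (Q j)‖ := by
    calc S.card * (Real.exp (l * (N * ε)) / 2)
        = ∑ Q ∈ S, Real.exp (l * (N * ε)) / 2 := by simp
      _ ≤ ∑ Q ∈ S, Real.cosh ‖∑ j, l • X (Q j)‖ := by
          refine Finset.sum_le_sum fun Q hQ => ?_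
          rw [← Finset.smul_sum, norm_smul, Real.norm_of_nonneg hl0, Real.cosh_eq]
          have h1 := Real.exp_le_exp.2 (mul_le_mul_of_nonneg_left (hS Q hQ) hl0)
          have h2 := Real.exp_pos (-(l * ‖∑ j, X (Q j)‖))
          linarith
      _ ≤ _ := Finset.sum_le_sum_of_subset_of_nonneg (Finset.subset_univ S)
          fun _ _ _ => (Real.cosh_pos _).le
  have hcosh : Real.cosh (l * B) ^ N ≤ Real.exp (N * ((l * B) ^ 2 / 2)) := by
    rw [Real.exp_nat_mul]
    exact pow_le_pow_left₀ (Real.cosh_pos _).le (Real.cosh_le_exp_half_sq _) N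
  have hexp : N * ((l * B) ^ 2 / 2) = -(N * ε ^ 2 / (2 * B ^ 2)) + l * (N * ε) := by
    rw [hl]
    field_simp
    ring
  have hpos := Real.exp_pos (l * (N * ε))
  have key : S.card * (Real.exp (l * (N * ε)) / 2) ≤
      (Fintype.card Ω : ℝ) ^ N *
        (Real.exp (-(N * ε ^ 2 / (2 * B ^ 2))) * Real.exp (l * (N * ε))) := by
    refine hlow.trans (hmgf.trans ?_)
    rw [mul_pow, ← Real.exp_add, ← hexp]
    gcongr
  refine le_of_mul_le_mul_right ?_ (half_pos hpos)
  linarith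

end Hoeffding

/-! ### The sampling law and the indicator vectors -/

theorem samplingLaw_apply {n k N : ℕ} (hk : 1 ≤ k) (S : Finset (Fin N → Traversal n k)) :
    samplingLaw n k N S =
      ENNReal.ofReal (S.card / (Fintype.card (Traversal n k) : ℝ) ^ N) := by
  have : Nonempty (Fin k) := ⟨⟨0, hk⟩⟩
  have hpos : (0 : ℝ) < Fintype.card (Traversal n k) := by exact_mod_cast Fintype.card_pos
  have hsing (Q : Fin N → Traversal n k) : samplingLaw n k N {Q} =
      ENNReal.ofReal (1 / (Fintype.card (Traversal n k) : ℝ) ^ N) := by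
    rw [samplingLaw, Measure.pi_singleton]
    simp only [uniformOn_univ, Measure.count_singleton, Finset.prod_const, Finset.card_univ,
      Fintype.card_fin]
    rw [← one_div_pow, ENNReal.ofReal_pow (by positivity), ENNReal.ofReal_div_of_pos hpos,
      ENNReal.ofReal_one, ENNReal.ofReal_natCast]
  rw [← sum_measure_singleton]
  simp only [hsing, Finset.sum_const, nsmul_eq_mul]
  rw [div_eq_mul_one_div (S.card : ℝ), ENNReal.ofReal_mul (by positivity), ENNReal.ofReal_natCast]

theorem isProbabilityMeasure_samplingLaw {n k : ℕ} (hk : 1 ≤ k) (N : ℕ) :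
    IsProbabilityMeasure (samplingLaw n k N) := by
  have : Nonempty (Fin k) := ⟨⟨0, hk⟩⟩
  have : IsProbabilityMeasure (uniformOn (Set.univ : Set (Traversal n k))) :=
    isProbabilityMeasure_uniformOn Set.finite_univ Set.univ_nonempty
  unfold samplingLaw
  infer_instance

section Deviation

variable {d n k : ℕ} (med : (Fin n → E d) → E d) (P : UncertainPoints d n k) (ε : ℝ)
  (T : Finset (E d))

open Classical in
/-- The indicator, as a real number, of the event that the median of the traversal `t` is assigned
to `z`. -/
noncomputable def hit (t : Traversal n k) (z : E d) : ℝ :=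
  if coverMap P ε T (med (t.points P)) = some z then 1 else 0

theorem sum_hit_eq (z : E d) :
    ∑ t : Traversal n k, hit med P ε T t z = (k : ℝ) ^ n * trueWeight med P ε T z := by
  classical
  rcases Nat.eq_zero_or_pos (k ^ n) with h0 | h0
  · have : IsEmpty (Traversal n k) := Fintype.card_eq_zero_iff.1 (by simpa using h0)
    have : (k : ℝ) ^ n = 0 := by exact_mod_cast h0
    simp [this]
  have hk : (k : ℝ) ^ n ≠ 0 := by exact_mod_cast h0.ne'
  unfold trueWeight medianWeight
  rw [← Finset.mul_sum, ← mul_assoc, mul_one_div_cancel hk, one_mul, Finset.sum_filter,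
    ← Finset.sum_fiberwise_of_maps_to (s := Finset.univ) (t := medianSet med P)
      (g := fun t : Traversal n k => med (t.points P))
      (fun t _ => Finset.mem_image_of_mem _ (Finset.mem_univ t))]
  refine Finset.sum_congr rfl fun q _ => ?_
  rw [Finset.sum_congr rfl fun t ht => by rw [hit, (Finset.mem_filter.1 ht).2]]
  split_ifs <;> simp

theorem sum_hit_le_one (t : Traversal n k) : ∑ z : T, hit med P ε T t z ≤ 1 := by
  classical
  rcases h : coverMap P ε T (med (t.points P)) with _ | y
  · simp [hit, h]
  · rw [Finset.sum_coe_sort T (hit med P ε T t)]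
    simp only [hit, h, Option.some_inj, Finset.sum_ite_eq]
    split_ifs <;> simp

theorem hit_mem_Icc (t : Traversal n k) (z : E d) : hit med P ε T t z ∈ Set.Icc (0 : ℝ) 1 := by
  unfold hit
  split_ifs <;> simp

theorem trueWeight_nonneg (z : E d) : 0 ≤ trueWeight med P ε T z := by
  unfold trueWeight medianWeight
  positivity

theorem sum_trueWeight_le_one (hk : 1 ≤ k) : ∑ z : T, trueWeight med P ε T z ≤ 1 := by
  have hpos : (0 : ℝ) < (k : ℝ) ^ n := by positivity
  refine le_of_mul_le_mul_left ?_ hpos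
  rw [Finset.mul_sum, mul_one]
  simp only [← sum_hit_eq]
  rw [Finset.sum_comm]
  calc _ ≤ ∑ _t : Traversal n k, (1 : ℝ) :=
        Finset.sum_le_sum fun t _ => sum_hit_le_one med P ε T t
    _ = _ := by simp

/-- The vector in `ℝ^T` of the indicators of the events `f_T(q) = z`, where `q` is the median of
the traversal `t`, centred by the true weights. -/
noncomputable def deviation (t : Traversal n k) : EuclideanSpace ℝ T :=
  WithLp.toLp 2 fun z : T => hit med P ε T t z - trueWeight med P ε T z

theorem sum_deviation : ∑ t : Traversal n k, deviation med P ε T t = 0 := by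
  ext z
  simp [deviation, sum_hit_eq]

theorem norm_deviation_le (hk : 1 ≤ k) (t : Traversal n k) :
    ‖deviation med P ε T t‖ ≤ √2 := by
  rw [EuclideanSpace.norm_eq]
  apply Real.sqrt_le_sqrt
  have hw1 (z : T) : trueWeight med P ε T z ≤ 1 :=
    (Finset.single_le_sum (f := fun z : T => trueWeight med P ε T z)
      (fun z _ => trueWeight_nonneg med P ε T z) (Finset.mem_univ z)).trans
      (sum_trueWeight_le_one med P ε T hk)
  calc ∑ z : T, ‖deviation med P ε T t z‖ ^ 2
      ≤ ∑ z : T, (hit med P ε T t z + trueWeight med P ε T z) := by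
        refine Finset.sum_le_sum fun z _ => ?_
        have h := hit_mem_Icc med P ε T t z
        have h0 := trueWeight_nonneg med P ε T z
        simp only [deviation, Real.norm_eq_abs, sq_abs]
        nlinarith [h.1, h.2, hw1 z, mul_nonneg h.1 h0]
    _ ≤ 2 := by
        rw [Finset.sum_add_distrib]
        linarith [sum_hit_le_one med P ε T t, sum_trueWeight_le_one med P ε T hk]

theorem sum_deviation_apply {N : ℕ} (hN : 0 < N) (Q : Fin N → Traversal n k) (z : T) :
    (∑ j, deviation med P ε T (Q j)) z =
      N * (empiricalWeight med P ε T Q z - trueWeight med P ε T z) := by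
  have hN' : (N : ℝ) ≠ 0 := by exact_mod_cast hN.ne'
  rw [mul_sub, empiricalWeight, mul_div_cancel₀ _ hN']
  simp [deviation, counter, hit]

end Deviation

end UncertainMedian

theorem mainTheorem4 :
    ∃ C : ℝ, 0 < C ∧
      ∀ (d n k : ℕ), 1 ≤ d → 1 ≤ n → 1 ≤ k →
      ∀ (P : UncertainMedian.UncertainPoints d n k)
        (med : (Fin n → UncertainMedian.E d) → UncertainMedian.E d),
        (∀ Q, UncertainMedian.IsL1Median (med Q) Q) →
      ∀ (T : Finset (UncertainMedian.E d)) (ε δ : ℝ), 0 < ε → 0 < δ → δ < 1 →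
      ∀ N : ℕ, C * ((1 / ε ^ 2) * ((d : ℝ) + Real.log (1 / δ))) ≤ (N : ℝ) →
        ENNReal.ofReal (1 - δ) <
          UncertainMedian.samplingLaw n k N
            {Q | ∀ z ∈ T, |UncertainMedian.empiricalWeight med P ε T Q z -
              UncertainMedian.trueWeight med P ε T z| ≤ ε} := by
  classical
  refine ⟨4, by norm_num, fun d n k hd _ hk P med _ T ε δ hε hδ hδ1 N hN => ?_⟩
  have hd' : (1 : ℝ) ≤ d := by exact_mod_cast hd
  have hlog : 0 < Real.log (1 / δ) := Real.log_pos (by rw [lt_div_iff₀ hδ]; linarith)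
  have hNpos : 0 < N := by
    have : (0 : ℝ) < N := lt_of_lt_of_le (by positivity) hN
    exact_mod_cast this
  have hNε : 1 + Real.log (1 / δ) ≤ N * ε ^ 2 / (2 * √2 ^ 2) := by
    have h := mul_le_mul_of_nonneg_right hN (sq_nonneg ε)
    have h2 : 4 * ((1 / ε ^ 2) * ((d : ℝ) + Real.log (1 / δ))) * ε ^ 2 =
        4 * (d + Real.log (1 / δ)) := by field_simp
    rw [Real.sq_sqrt (by norm_num : (0 : ℝ) ≤ 2)]
    linarith
  have := UncertainMedian.isProbabilityMeasure_samplingLaw (n := n) hk N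
  have : Nonempty (Fin k) := ⟨⟨0, hk⟩⟩
  set G : Set (Fin N → UncertainMedian.Traversal n k) :=
    {Q | ∀ z ∈ T, |UncertainMedian.empiricalWeight med P ε T Q z -
      UncertainMedian.trueWeight med P ε T z| ≤ ε} with hG
  have hcard := UncertainMedian.card_norm_sum_ge_le
    (UncertainMedian.sum_deviation med P ε T)
    (UncertainMedian.norm_deviation_le med P ε T hk) (by positivity) hε.le N Gᶜ.toFinset
    (fun Q hQ => by
      simp only [hG, Set.mem_toFinset, Set.mem_compl_iff, Set.mem_ofPred_eq, not_forall,
        not_le] at hQ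
      obtain ⟨z, hz, hlt⟩ := hQ
      have h := PiLp.norm_apply_le
        (∑ j, UncertainMedian.deviation med P ε T (Q j)) ⟨z, hz⟩
      rw [UncertainMedian.sum_deviation_apply med P ε T hNpos, norm_mul, Real.norm_eq_abs,
        Real.norm_eq_abs, Nat.abs_cast] at h
      exact (mul_le_mul_of_nonneg_left hlt.le (Nat.cast_nonneg N)).trans h)
  have hΩ : (0 : ℝ) < Fintype.card (UncertainMedian.Traversal n k) := by
    exact_mod_cast Fintype.card_pos
  have hbound : 2 * Real.exp (-(N * ε ^ 2 / (2 * √2 ^ 2))) < δ := by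
    calc 2 * Real.exp (-(N * ε ^ 2 / (2 * √2 ^ 2)))
        ≤ 2 * Real.exp (Real.log δ + -1) := by
          gcongr
          rw [one_div, Real.log_inv] at hNε
          linarith
      _ = δ * (2 * Real.exp (-1)) := by rw [Real.exp_add, Real.exp_log hδ]; ring
      _ < δ * 1 := by
          gcongr
          rw [Real.exp_neg, ← div_eq_mul_inv, div_lt_one (Real.exp_pos 1)]
          linarith [Real.exp_one_gt_d9]
      _ = δ := mul_one δ
  have hbad : UncertainMedian.samplingLaw n k N Gᶜ < ENNReal.ofReal δ := by
    rw [← Set.coe_toFinset Gᶜ, UncertainMedian.samplingLaw_apply hk,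
      ENNReal.ofReal_lt_ofReal_iff hδ, div_lt_iff₀ (by positivity)]
    exact hcard.trans_lt (by gcongr)
  rw [ENNReal.ofReal_sub 1 hδ.le, ENNReal.ofReal_one]
  refine ENNReal.sub_lt_of_lt_add (ENNReal.ofReal_le_one.2 hδ1.le) ?_
  rw [← prob_add_prob_compl (μ := UncertainMedian.samplingLaw n k N) (Set.toFinite G).measurableSet]
  exact ENNReal.add_lt_add_left (measure_ne_top _ _) hbad
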